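/- Let $d\ge 1$ and let $(X,Y),(X_1,Y_1),(X_2,Y_2),\dots$ be i.i.d. random pairs in $[0,1]^d\times\mathbb R$. Let $g(x)=\mathbb E[Y\mid X=x]$ be $L$-Lipschitz on $[0,1]^d$ for the Euclidean norm, let $X$ have a density on $[0,1]^d$ that is $\ge b>0$ there, and let $\varepsilon=Y-g(X)$ satisfy $\mathbb E[\varepsilon\mid X]=0$ and $\mathbb E[e^{t\varepsilon}\mid X]\le e^{\sigma^2t^2/2}$ almost surely for every $t\in\mathbb R$, where $\sigma\ge 0$. Let $(D_i,S_i)_{i\ge 1}$ describe a centered random tree: the $D_i$ are independent and uniform on $\{1,\dots,d\}$ and $S_i=1/2$ almost surely. For $x\in[0,1]^d$ the cell $\mathcal V_N(x)$ of $x$ after $N$ splits is obtained from $\mathcal V_0(x)=[0,1]^d$ by cutting, at step $i$, the current cell in direction $D_i$ at $a+(c-a)S_i$, where $a<c$ are the end points of its side in that direction, and keeping the part that contains $x$ (points on the cut belong to the lower part). For $n\ge 1$ put $$\hat g_n(x)=\frac{\sum_{i=1}^nY_i\mathbf 1\{X_i\in\mathcal V_{N_n}(x)\}}{\sum_{i=1}^n\mathbf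 1\{X_i\in\mathcal V_{N_n}(x)\}}\quad(0/0=0),$$ where $N_n$ is the number $\frac{d\log n}{(d+2)\log 2}$ rounded to an integer, up or down. (i) There is a constant $C>0$ that depends only on $d,b,\sigma,L$ such that, if the tree $(D_i,S_i)_{i\ge1}$ is independent of the sample $(X_i,Y_i)_{i\ge 1}$, then for every $x\in[0,1]^d$, almost surely, there is $n_0$ such that for all $n\ge n_0$ $$|\hat g_n(x)-g(x)|\le C\,n^{-1/(d+2)}\,e^{2\sqrt{\log n\,\log\log n}}.$$ (ii) Centered trees are not shape-regular: if $d\ge 2$, then for every $N\ge d$ and every $x\in[0,1]^d$, with probability at least $1/14$, $$\frac{h_+(\mathcal V_N(x))}{h_-(\mathcal V_N(x))}\ge 2^{\sqrt{N/d}},$$ where $h_+$ and $h_-$ are the largest and the smallest side length of the cell. -/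

import Mathlib

open MeasureTheory ProbabilityTheory
open scoped NNReal ENNReal

noncomputable section

/-- The covariate space `ℝ^d` with the Euclidean norm. -/
abbrev Covariate (d : ℕ) : Type := EuclideanSpace ℝ (Fin d)

/-- The cube `[0,1]^d`, the support `S_X` of the covariates. -/
def unitCube (d : ℕ) : Set (Covariate d) :=
  {z | ∀ k, z k ∈ Set.Icc (0 : ℝ) 1}

/-! ### The cell of a random tree that contains a given point -/

/-- Lower and upper end points of the sides of the cell containing `x` after each number of splits.
The `i`-th split cuts the side `(a, c)` in direction `D i` at `a + (c - a) * S i`; the part in which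
the coordinate `x (D i)` lies is kept (the lower part when `x (D i)` is the cut point). -/
def cellBounds {d : ℕ} (x : Covariate d) (D : ℕ → Fin d) (S : ℕ → ℝ) :
    ℕ → (Fin d → ℝ) × (Fin d → ℝ)
  | 0 => (fun _ => 0, fun _ => 1)
  | i + 1 =>
    let p := cellBounds x D S i
    let cut := p.1 (D i) + (p.2 (D i) - p.1 (D i)) * S i
    if x (D i) ≤ cut then (p.1, Function.update p.2 (D i) cut)
    else (Function.update p.1 (D i) cut, p.2)

/-- The position at which the cell containing `x` is cut by the split of index `i`. -/
def cutPoint {d : ℕ} (x : Covariate d) (D : ℕ → Fin d) (S : ℕ → ℝ) (i : ℕ) : ℝ :=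
  (cellBounds x D S i).1 (D i)
    + ((cellBounds x D S i).2 (D i) - (cellBounds x D S i).1 (D i)) * S i

/-- The cell `𝒱(x, (D_i, S_i)_{i < N})` containing `x` after `N` splits: one starts from `[0,1]^d`,
and each split keeps the points of the current cell on the same side of the cut as `x`. -/
def treeCell {d : ℕ} (x : Covariate d) (D : ℕ → Fin d) (S : ℕ → ℝ) : ℕ → Set (Covariate d)
  | 0 => unitCube d
  | i + 1 => {z | z ∈ treeCell x D S i ∧
      (z (D i) ≤ cutPoint x D S i ↔ x (D i) ≤ cutPoint x D S i)}

/-- The length of the side of a hyper-rectangle `A` in direction `k`. -/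
def sideLength {d : ℕ} (A : Set (Covariate d)) (k : Fin d) : ℝ :=
  Metric.diam ((fun z : Covariate d => z k) '' A)

/-- The largest side length `h₊(A)`. -/
def maxSide {d : ℕ} (A : Set (Covariate d)) : ℝ := ⨆ k, sideLength A k

/-- The smallest side length `h₋(A)`. -/
def minSide {d : ℕ} (A : Set (Covariate d)) : ℝ := ⨅ k, sideLength A k

/-- The splitting variables of a centered random tree: the directions are independent and uniform
on the `d` coordinates, and every cut is at the middle, almost surely. -/
structure IsCenteredTree {d : ℕ} {Ω : Type*} [MeasurableSpace Ω] (μ : Measure Ω)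
    (D : ℕ → Ω → Fin d) (S : ℕ → Ω → ℝ) : Prop where
  measurable_dir : ∀ i, Measurable (D i)
  indep_dir : iIndepFun D μ
  uniform_dir : ∀ i k, μ (D i ⁻¹' {k}) = (d : ℝ≥0∞)⁻¹
  split_half : ∀ i, ∀ᵐ ω ∂μ, S i ω = 1 / 2

/-! ### The regression model -/

/-- The σ-algebra generated by the covariate, on the space of pairs (covariate, response). -/
abbrev covariateSigma (d : ℕ) : MeasurableSpace (Covariate d × ℝ) :=
  MeasurableSpace.comap Prod.fst inferInstance

/-- `g(x) = 𝔼[Y | X = x]` for `(X, Y)` of law `P`. -/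
def IsRegressionFunction {d : ℕ} (P : Measure (Covariate d × ℝ)) (g : Covariate d → ℝ) : Prop :=
  Integrable (fun z => z.2) P ∧
    P[(fun z : Covariate d × ℝ => z.2) | covariateSigma d] =ᵐ[P] fun z => g z.1

/-- The noise `ε = Y - g(X)` is sub-Gaussian with parameter `σ²` conditionally on `X`:
`𝔼[ε | X] = 0` and `𝔼[exp(t ε) | X] ≤ exp(σ² t² / 2)` for all real `t`. -/
def SubGaussianNoise {d : ℕ} (P : Measure (Covariate d × ℝ)) (g : Covariate d → ℝ) (σ : ℝ) :
    Prop :=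
  Integrable (fun z => z.2 - g z.1) P ∧
  P[(fun z : Covariate d × ℝ => z.2 - g z.1) | covariateSigma d] =ᵐ[P] 0 ∧
  ∀ t : ℝ, Integrable (fun z => Real.exp (t * (z.2 - g z.1))) P ∧
    P[(fun z : Covariate d × ℝ => Real.exp (t * (z.2 - g z.1))) | covariateSigma d]
      ≤ᵐ[P] fun _ => Real.exp (σ ^ 2 * t ^ 2 / 2)

/-- The covariate has a density on `[0,1]^d` with respect to Lebesgue measure, and the density is
at least `b` there. -/
def DensityBoundedBelow {d : ℕ} (P : Measure (Covariate d × ℝ)) (b : ℝ) : Prop :=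
  ∃ f : Covariate d → ℝ, Measurable f ∧ (∀ z ∈ unitCube d, b ≤ f z) ∧
    P.map Prod.fst = (volume.restrict (unitCube d)).withDensity (fun z => ENNReal.ofReal (f z))

/-- The pairs `Z i = (X_i, Y_i)` are independent with common law `P`. -/
structure IsSample {d : ℕ} {Ω : Type*} [MeasurableSpace Ω] (μ : Measure Ω)
    (P : Measure (Covariate d × ℝ)) (Z : ℕ → Ω → Covariate d × ℝ) : Prop where
  measurable_pair : ∀ i, Measurable (Z i)
  indep_pair : iIndepFun Z μ
  law_pair : ∀ i, μ.map (Z i) = P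

open Classical in
/-- The local average of the first `n` responses over the observations with covariate in `V`
(`0 / 0 = 0`). -/
def localAverage {d : ℕ} (n : ℕ) (V : Set (Covariate d)) (Z : ℕ → Covariate d × ℝ) : ℝ :=
  (∑ i ∈ Finset.range n, if (Z i).1 ∈ V then (Z i).2 else 0) /
    (∑ i ∈ Finset.range n, if (Z i).1 ∈ V then (1 : ℝ) else 0)

end

/-! Every cut halves a side, so after `N` splits the side in direction `k` has length `2^(-K_k)`,
where `K_k = splitCount` does not depend on `x`, and the volume is `2^(-N)` whatever the shape. Both
claims are thus about fluctuations of the counts `K_k` around `N/d`.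

Rate. Put `r = n^(-1/(d+2))`; then `2^(-N/d)` is of order `r` and `n 2^(-N)` of order `r^(-2)`.
Hoeffding and Borel–Cantelli give `K_k ≥ N/d - √(N log N)` eventually
(`IsCenteredTree.ae_eventually_splitCount_ge`), so the Lipschitz bias is at most a constant times `r
2^√(N log N)`, which produces the factor `exp(2√(log n log log n))`. In a fixed cell, Chernoff
bounds show that at least a constant times `r^(-2)` points fall in it and that their average noise
is `O(r √(log n))`, up to probability `O(n^(-2))` (`IsSample.measure_badCell_le`). Since tree and
sample are independent, this bound holds for the random cell without a union bound over cells
(`IndepFun.measure_preimage_le_of_forall`), and Borel–Cantelli in `n` concludes.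

Shape. `K_k - K_l` is a centered walk of variance `2N/d`; its second and fourth moments and a
Paley–Zygmund bound give `(K_k - K_l)^2 ≥ N/d` with probability at least `1/14`, and the ratio of
these two sides is `2^|K_k - K_l|`. -/

/-! ### Geometry of the cells of a centered tree -/

/-- The number of the first `N` splits that are made in direction `k`. -/
def splitCount {d : ℕ} (D : ℕ → Fin d) (N : ℕ) (k : Fin d) : ℕ :=
  ∑ i ∈ Finset.range N, if D i = k then 1 else 0

lemma splitCount_succ {d : ℕ} (D : ℕ → Fin d) (N : ℕ) (k : Fin d) :
    splitCount D (N + 1) k = splitCount D N k + if D N = k then 1 else 0 := by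
  rw [splitCount, splitCount, Finset.sum_range_succ]

lemma sum_splitCount {d : ℕ} (D : ℕ → Fin d) (N : ℕ) : ∑ k, splitCount D N k = N := by
  unfold splitCount
  rw [Finset.sum_comm]
  simp

section Cells

variable {d : ℕ} {x : Covariate d} {D : ℕ → Fin d} {S : ℕ → ℝ}

lemma cellBounds_width (hS : ∀ i, S i = 1 / 2) (N : ℕ) (k : Fin d) :
    (cellBounds x D S N).2 k - (cellBounds x D S N).1 k = (1 / 2 : ℝ) ^ splitCount D N k := by
  induction N with
  | zero => simp [cellBounds, splitCount]
  | succ N ih =>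
    rw [splitCount_succ]
    simp only [cellBounds, hS]
    by_cases hk : D N = k
    · subst hk
      rw [if_pos rfl, pow_succ, ← ih]
      split_ifs <;> simp only [Function.update_self] <;> ring
    · rw [if_neg hk, add_zero, ← ih]
      split_ifs <;> simp only [Function.update_of_ne (Ne.symm hk)]

lemma cellBounds_lt (hS : ∀ i, S i = 1 / 2) (N : ℕ) (k : Fin d) :
    (cellBounds x D S N).1 k < (cellBounds x D S N).2 k := by
  have h := cellBounds_width (x := x) (D := D) hS N k
  have : (0 : ℝ) < (1 / 2 : ℝ) ^ splitCount D N k := by positivity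
  linarith

lemma cellBounds_lower_nonneg (hS : ∀ i, S i = 1 / 2) (N : ℕ) (k : Fin d) :
    0 ≤ (cellBounds x D S N).1 k := by
  induction N with
  | zero => simp [cellBounds]
  | succ N ih =>
    have h := cellBounds_lt (x := x) (D := D) hS N k
    simp only [cellBounds, hS]
    split_ifs
    · exact ih
    · by_cases hk : D N = k
      · subst hk
        simp only [Function.update_self]
        linarith
      · simpa [Function.update_of_ne (Ne.symm hk)] using ih

/-- The interval of which the cell of `x` is the product: it is closed on the left exactly when its
left end point is `0`. -/
def cellInterval (x : Covariate d) (D : ℕ → Fin d) (S : ℕ → ℝ) (N : ℕ) (k : Fin d) : Set ℝ :=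
  {t | 0 ≤ t ∧ t ≤ (cellBounds x D S N).2 k ∧
    ((cellBounds x D S N).1 k = 0 ∨ (cellBounds x D S N).1 k < t)}

lemma mem_treeCell_iff (hS : ∀ i, S i = 1 / 2) (N : ℕ) (z : Covariate d) :
    z ∈ treeCell x D S N ↔ ∀ k, z k ∈ cellInterval x D S N k := by
  induction N with
  | zero => simp [treeCell, unitCube, cellInterval, cellBounds]
  | succ N ih =>
    have hlt := cellBounds_lt (x := x) (D := D) hS N (D N)
    have h0 := cellBounds_lower_nonneg (x := x) (D := D) hS N (D N)
    have hcut : cutPoint x D S N = (cellBounds x D S N).1 (D N)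
      + ((cellBounds x D S N).2 (D N) - (cellBounds x D S N).1 (D N)) * S N := rfl
    have hcut' : cutPoint x D S N =
        ((cellBounds x D S N).1 (D N) + (cellBounds x D S N).2 (D N)) / 2 := by
      rw [hcut, hS]; ring
    simp only [treeCell, Set.mem_ofPred_eq, ih]
    have hother : ∀ k, k ≠ D N → cellInterval x D S (N + 1) k = cellInterval x D S N k := by
      intro k hk
      simp only [cellInterval, cellBounds]
      split_ifs <;> simp [Function.update_of_ne hk]
    have hself : z (D N) ∈ cellInterval x D S (N + 1) (D N) ↔
        z (D N) ∈ cellInterval x D S N (D N) ∧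
          (z (D N) ≤ cutPoint x D S N ↔ x (D N) ≤ cutPoint x D S N) := by
      simp only [cellInterval, cellBounds, ← hcut]
      split_ifs with hx
      · simp only [Function.update_self, Set.mem_ofPred_eq, hx, iff_true]
        constructor
        · rintro ⟨h1, h2, h3⟩
          exact ⟨⟨h1, by linarith, h3⟩, h2⟩
        · rintro ⟨⟨h1, h2, h3⟩, h4⟩
          exact ⟨h1, h4, h3⟩
      · simp only [Function.update_self, Set.mem_ofPred_eq, hx, iff_false, not_le]
        constructor
        · rintro ⟨h1, h2, h3⟩
          -- The cut is the midpoint of an interval with nonnegative left end, hence positive: a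
          -- left end that has moved is never `0`, and the new side is open there.
          have : cutPoint x D S N < z (D N) := by
            rcases h3 with h3 | h3
            · linarith
            · exact h3
          exact ⟨⟨h1, h2, Or.inr (by linarith)⟩, this⟩
        · rintro ⟨⟨h1, h2, h3⟩, h4⟩
          exact ⟨h1, h2, Or.inr h4⟩
    constructor
    · rintro ⟨h1, h2⟩ k
      by_cases hk : k = D N
      · subst hk
        exact hself.2 ⟨h1 _, h2⟩
      · rw [hother k hk]
        exact h1 k
    · intro h
      refine ⟨fun k => ?_, (hself.1 (h _)).2⟩
      by_cases hk : k = D N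
      · subst hk
        exact (hself.1 (h _)).1
      · rw [← hother k hk]
        exact h k

lemma self_mem_treeCell (hx : x ∈ unitCube d) (N : ℕ) : x ∈ treeCell x D S N := by
  induction N with
  | zero => exact hx
  | succ N ih => exact ⟨ih, Iff.rfl⟩

lemma treeCell_subset_unitCube (N : ℕ) : treeCell x D S N ⊆ unitCube d := by
  induction N with
  | zero => exact subset_rfl
  | succ N ih => exact fun z hz => ih hz.1

lemma measurableSet_unitCube (d : ℕ) : MeasurableSet (unitCube d) := by
  simp only [unitCube, Set.ofPred_forall]
  exact MeasurableSet.iInter fun k =>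
    measurableSet_Icc.preimage (by fun_prop : Measurable fun z : Covariate d => z k)

lemma measurableSet_treeCell (N : ℕ) : MeasurableSet (treeCell x D S N) := by
  induction N with
  | zero => exact measurableSet_unitCube d
  | succ N ih =>
    refine ih.inter (MeasurableSet.iff ?_ (MeasurableSet.const _))
    exact measurableSet_Iic.preimage (by fun_prop : Measurable fun z : Covariate d => z (D N))

/-- Allows the infinite direction sequence to be replaced by its first `N` terms, which take
finitely many values. -/
lemma treeCell_congr {D' : ℕ → Fin d} {S' : ℕ → ℝ} {N : ℕ}
    (hD : ∀ i < N, D i = D' i) (hS : ∀ i < N, S i = S' i) :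
    treeCell x D S N = treeCell x D' S' N := by
  have hb : ∀ m ≤ N, cellBounds x D S m = cellBounds x D' S' m := by
    intro m
    induction m with
    | zero => intro _; rfl
    | succ m ih =>
      intro hm
      simp only [cellBounds, ih (by omega), hD m (by omega), hS m (by omega)]
  have hc : ∀ m ≤ N, treeCell x D S m = treeCell x D' S' m := by
    intro m
    induction m with
    | zero => intro _; rfl
    | succ m ih =>
      intro hm
      simp only [treeCell, cutPoint, ih (by omega), hb m (by omega), hD m (by omega),
        hS m (by omega)]
  exact hc N le_rfl

lemma cellInterval_subset_Icc (N : ℕ) (k : Fin d) : cellInterval x D S N k ⊆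
    Set.Icc ((cellBounds x D S N).1 k) ((cellBounds x D S N).2 k) := by
  rintro t ⟨h0, h1, h2⟩
  refine ⟨?_, h1⟩
  rcases h2 with h2 | h2 <;> linarith

lemma Ioc_subset_cellInterval (hS : ∀ i, S i = 1 / 2) (N : ℕ) (k : Fin d) :
    Set.Ioc ((cellBounds x D S N).1 k) ((cellBounds x D S N).2 k) ⊆ cellInterval x D S N k := by
  rintro t ⟨h0, h1⟩
  exact ⟨(cellBounds_lower_nonneg hS N k).trans h0.le, h1, Or.inr h0⟩

lemma image_treeCell (hS : ∀ i, S i = 1 / 2) (hx : x ∈ unitCube d) (N : ℕ) (k : Fin d) :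
    (fun z : Covariate d => z k) '' treeCell x D S N = cellInterval x D S N k := by
  ext t
  constructor
  · rintro ⟨z, hz, rfl⟩
    exact (mem_treeCell_iff hS N z).1 hz k
  · intro ht
    refine ⟨WithLp.toLp 2 (Function.update (fun j => x j) k t), ?_, by simp⟩
    rw [mem_treeCell_iff hS]
    intro j
    by_cases hj : j = k
    · subst hj; simpa using ht
    · simpa [Function.update_of_ne hj] using
        (mem_treeCell_iff hS N x).1 (self_mem_treeCell hx N) j

lemma sideLength_treeCell (hS : ∀ i, S i = 1 / 2) (hx : x ∈ unitCube d) (N : ℕ) (k : Fin d) :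
    sideLength (treeCell x D S N) k = (1 / 2 : ℝ) ^ splitCount D N k := by
  have hlt := (cellBounds_lt (x := x) (D := D) hS N k).le
  rw [sideLength, image_treeCell hS hx, ← cellBounds_width (x := x) hS N k]
  refine le_antisymm ?_ ?_
  · exact (Metric.diam_mono (cellInterval_subset_Icc N k) (Metric.isBounded_Icc _ _)).trans_eq
      (Real.diam_Icc hlt)
  · rw [← Real.diam_Ioc hlt]
    exact Metric.diam_mono (Ioc_subset_cellInterval hS N k)
      ((Metric.isBounded_Icc _ _).subset (cellInterval_subset_Icc N k))

lemma abs_sub_le_of_mem_treeCell (hS : ∀ i, S i = 1 / 2) (hx : x ∈ unitCube d) {N : ℕ}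
    {z : Covariate d} (hz : z ∈ treeCell x D S N) (k : Fin d) :
    |z k - x k| ≤ (1 / 2 : ℝ) ^ splitCount D N k := by
  rw [← cellBounds_width (x := x) hS N k]
  have h1 := cellInterval_subset_Icc N k ((mem_treeCell_iff hS N z).1 hz k)
  have h2 := cellInterval_subset_Icc (D := D) N k
    ((mem_treeCell_iff hS N x).1 (self_mem_treeCell hx N) k)
  rw [abs_le]
  constructor <;> linarith [h1.1, h1.2, h2.1, h2.2]

/-- The side lengths multiply to `2^(-N)` because the counts sum to `N`. An elongated cell therefore
receives as much mass as a cubic one, and irregular shape costs only in the bias. -/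
lemma volume_treeCell_ge (hS : ∀ i, S i = 1 / 2) (N : ℕ) :
    ENNReal.ofReal ((1 / 2 : ℝ) ^ N) ≤ volume (treeCell x D S N) := by
  have hsub : WithLp.ofLp ⁻¹' (Set.univ.pi fun k =>
      Set.Ioc ((cellBounds x D S N).1 k) ((cellBounds x D S N).2 k)) ⊆ treeCell x D S N := by
    intro z hz
    rw [mem_treeCell_iff hS]
    exact fun k => Ioc_subset_cellInterval hS N k (hz k (Set.mem_univ k))
  refine le_trans ?_ (measure_mono hsub)
  rw [(PiLp.volume_preserving_ofLp (Fin d)).measure_preimage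
    (MeasurableSet.univ_pi fun _ => measurableSet_Ioc).nullMeasurableSet, Real.volume_pi_Ioc,
    ← ENNReal.ofReal_prod_of_nonneg fun k _ => by linarith [cellBounds_lt (x := x) (D := D) hS N k]]
  simp only [cellBounds_width hS, Finset.prod_pow_eq_pow_sum, sum_splitCount, le_refl]

lemma norm_sub_le_of_mem_treeCell (hS : ∀ i, S i = 1 / 2) (hx : x ∈ unitCube d) {N : ℕ}
    {z : Covariate d} (hz : z ∈ treeCell x D S N) {r : ℝ}
    (hr : ∀ k, (1 / 2 : ℝ) ^ splitCount D N k ≤ r) : ‖z - x‖ ≤ d * r := by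
  rcases Nat.eq_zero_or_pos d with rfl | hd
  · simp [Subsingleton.elim z x]
  have hr0 : 0 ≤ r := le_trans (by positivity) (hr ⟨0, hd⟩)
  have hd1 : (1 : ℝ) ≤ d := by exact_mod_cast hd
  rw [EuclideanSpace.norm_eq]
  refine Real.sqrt_le_iff.2 ⟨by positivity, ?_⟩
  calc ∑ k, ‖(z - x) k‖ ^ 2 ≤ ∑ _k : Fin d, r ^ 2 := by
        refine Finset.sum_le_sum fun k _ => ?_
        gcongr
        simpa using (abs_sub_le_of_mem_treeCell hS hx hz k).trans (hr k)
    _ = d * r ^ 2 := by simp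
    _ ≤ (d * r) ^ 2 := by
        rw [mul_pow]
        exact mul_le_mul_of_nonneg_right (by nlinarith) (sq_nonneg r)

end Cells

/-! ### Moments of a bounded centered random walk -/

section Moments

variable {Ω : Type*} [MeasurableSpace Ω] {μ : Measure Ω}

lemma integrable_of_abs_le [IsFiniteMeasure μ] {f : Ω → ℝ} (hf : Measurable f) {c : ℝ}
    (h : ∀ ω, |f ω| ≤ c) : Integrable f μ :=
  Integrable.of_bound hf.aestronglyMeasurable c (Filter.Eventually.of_forall h)

variable {ξ : ℕ → Ω → ℝ}

lemma integral_walk_pow_mul_step_pow (hm : ∀ i, Measurable (ξ i)) (hind : iIndepFun ξ μ)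
    (n p q : ℕ) :
    ∫ ω, (∑ i ∈ Finset.range n, ξ i ω) ^ p * ξ n ω ^ q ∂μ =
      (∫ ω, (∑ i ∈ Finset.range n, ξ i ω) ^ p ∂μ) * ∫ ω, ξ n ω ^ q ∂μ := by
  have h := hind.indepFun_sum_range_succ hm n
  have h2 := h.comp (φ := fun t : ℝ => t ^ p) (ψ := fun t : ℝ => t ^ q) (by fun_prop) (by fun_prop)
  have h3 := h2.integral_fun_mul_eq_mul_integral
    (Measurable.aestronglyMeasurable (by fun_prop)) (Measurable.aestronglyMeasurable (by fun_prop))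
  simpa [Function.comp_def, Finset.sum_apply] using h3

lemma integrable_walk_pow_mul_step_pow [IsFiniteMeasure μ] (hm : ∀ i, Measurable (ξ i))
    (hb : ∀ i ω, |ξ i ω| ≤ 1) (n p q : ℕ) :
    Integrable (fun ω => (∑ i ∈ Finset.range n, ξ i ω) ^ p * ξ n ω ^ q) μ := by
  refine integrable_of_abs_le (by fun_prop) (c := (n : ℝ) ^ p) fun ω => ?_
  rw [abs_mul, abs_pow, abs_pow]
  have h1 : |∑ i ∈ Finset.range n, ξ i ω| ≤ n :=
    (Finset.abs_sum_le_sum_abs _ _).trans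
      ((Finset.sum_le_sum fun i _ => hb i ω).trans_eq (by simp))
  calc |∑ i ∈ Finset.range n, ξ i ω| ^ p * |ξ n ω| ^ q ≤ (n : ℝ) ^ p * 1 := by
        gcongr
        exact pow_le_one₀ (abs_nonneg _) (hb n ω)
    _ = (n : ℝ) ^ p := mul_one _

lemma integral_walk_sq [IsProbabilityMeasure μ] (hm : ∀ i, Measurable (ξ i))
    (hind : iIndepFun ξ μ) (hb : ∀ i ω, |ξ i ω| ≤ 1) {v : ℝ} (h1 : ∀ i, ∫ ω, ξ i ω ∂μ = 0)
    (h2 : ∀ i, ∫ ω, ξ i ω ^ 2 ∂μ = v) (n : ℕ) :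
    ∫ ω, (∑ i ∈ Finset.range n, ξ i ω) ^ 2 ∂μ = n * v := by
  induction n with
  | zero => simp
  | succ n ih =>
    have hI := integrable_walk_pow_mul_step_pow (μ := μ) hm hb n
    have hE := integral_walk_pow_mul_step_pow hm hind n
    -- The zeroth powers are kept so that every term is a product of a power of the walk and a power
    -- of the next step, to which `hI` and `hE` apply.
    have e : ∀ ω, (∑ i ∈ Finset.range (n + 1), ξ i ω) ^ 2 =
        (∑ i ∈ Finset.range n, ξ i ω) ^ 2 * ξ n ω ^ 0
        + 2 * ((∑ i ∈ Finset.range n, ξ i ω) ^ 1 * ξ n ω ^ 1)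
        + (∑ i ∈ Finset.range n, ξ i ω) ^ 0 * ξ n ω ^ 2 := by
      intro ω; rw [Finset.sum_range_succ]; ring
    simp_rw [e]
    rw [integral_add ((hI 2 0).fun_add ((hI 1 1).const_mul 2)) (hI 0 2),
      integral_add (hI 2 0) ((hI 1 1).const_mul 2), integral_const_mul, hE, hE, hE]
    simp only [pow_zero, pow_one, h1, h2, ih]
    simp
    ring

/-- The odd moments of a step vanish, so step `n + 1` adds `6 (n v) v + w`; summing gives `3 n (n -
1) v^2 + n w`. -/
lemma integral_walk_pow_four [IsProbabilityMeasure μ] (hm : ∀ i, Measurable (ξ i))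
    (hind : iIndepFun ξ μ) (hb : ∀ i ω, |ξ i ω| ≤ 1) {v w : ℝ} (h1 : ∀ i, ∫ ω, ξ i ω ∂μ = 0)
    (h2 : ∀ i, ∫ ω, ξ i ω ^ 2 ∂μ = v) (h3 : ∀ i, ∫ ω, ξ i ω ^ 3 ∂μ = 0)
    (h4 : ∀ i, ∫ ω, ξ i ω ^ 4 ∂μ = w) (n : ℕ) :
    ∫ ω, (∑ i ∈ Finset.range n, ξ i ω) ^ 4 ∂μ = n * w + 3 * n * (n - 1) * v ^ 2 := by
  induction n with
  | zero => simp
  | succ n ih =>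
    have hI := integrable_walk_pow_mul_step_pow (μ := μ) hm hb n
    have hE := integral_walk_pow_mul_step_pow hm hind n
    have e : ∀ ω, (∑ i ∈ Finset.range (n + 1), ξ i ω) ^ 4 =
        (∑ i ∈ Finset.range n, ξ i ω) ^ 4 * ξ n ω ^ 0
        + 4 * ((∑ i ∈ Finset.range n, ξ i ω) ^ 3 * ξ n ω ^ 1)
        + 6 * ((∑ i ∈ Finset.range n, ξ i ω) ^ 2 * ξ n ω ^ 2)
        + 4 * ((∑ i ∈ Finset.range n, ξ i ω) ^ 1 * ξ n ω ^ 3)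
        + (∑ i ∈ Finset.range n, ξ i ω) ^ 0 * ξ n ω ^ 4 := by
      intro ω; rw [Finset.sum_range_succ]; ring
    simp_rw [e]
    have i1 := (hI 4 0).fun_add ((hI 3 1).const_mul 4)
    have i2 := i1.fun_add ((hI 2 2).const_mul 6)
    have i3 := i2.fun_add ((hI 1 3).const_mul 4)
    rw [integral_add i3 (hI 0 4), integral_add i2 ((hI 1 3).const_mul 4),
      integral_add i1 ((hI 2 2).const_mul 6), integral_add (hI 4 0) ((hI 3 1).const_mul 4),
      integral_const_mul, integral_const_mul, integral_const_mul, hE, hE, hE, hE, hE,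
      integral_walk_sq hm hind hb h1 h2]
    simp only [pow_zero, pow_one, h1, h2, h3, h4, ih]
    simp
    ring

/-- A Paley–Zygmund type bound. -/
lemma measureReal_half_le_ge [IsProbabilityMeasure μ] {U : Ω → ℝ} (hU : Measurable U)
    (h0 : ∀ ω, 0 ≤ U ω) (hi : Integrable U μ) (hi2 : Integrable (fun ω => U ω ^ 2) μ) {s : ℝ}
    (hs : 0 ≤ s) :
    s * ∫ ω, U ω ∂μ - s ^ 2 * ∫ ω, U ω ^ 2 ∂μ ≤ μ.real {ω | (∫ ω, U ω ∂μ) / 2 ≤ U ω} := by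
  set m := ∫ ω, U ω ∂μ with hm
  have hi' : Integrable (fun ω => 2 * s * U ω - s * m) μ :=
    (hi.const_mul _).sub (integrable_const _)
  have hB : MeasurableSet {ω | m / 2 ≤ U ω} := measurableSet_le measurable_const hU
  -- Integrates `2sU - sm - (sU)^2 ≤ 1_{U ≥ m/2}`: on the event because `2sU - (sU)^2 ≤ 1`, off it
  -- because `2sU ≤ sm`. A free `s` avoids Cauchy–Schwarz and division by a moment.
  calc s * m - s ^ 2 * ∫ ω, U ω ^ 2 ∂μ
      = ∫ ω, (2 * s * U ω - s * m - s ^ 2 * U ω ^ 2) ∂μ := by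
        rw [integral_sub hi' (hi2.const_mul _),
          integral_sub (hi.const_mul _) (integrable_const _), integral_const,
          integral_const_mul, integral_const_mul, ← hm]
        simp
        ring
    _ ≤ ∫ ω, Set.indicator {ω | m / 2 ≤ U ω} 1 ω ∂μ := by
        refine integral_mono (hi'.sub (hi2.const_mul _))
          ((integrable_const (1 : ℝ)).indicator hB) fun ω => ?_
        have hm0 : 0 ≤ m := integral_nonneg h0
        by_cases h : m / 2 ≤ U ω
        · rw [Set.indicator_of_mem (by exact h)]
          simp only [Pi.one_apply]
          nlinarith [sq_nonneg (1 - s * U ω), mul_nonneg hs hm0]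
        · rw [Set.indicator_of_notMem (by exact h)]
          push Not at h
          nlinarith [sq_nonneg (s * U ω)]
    _ = μ.real {ω | m / 2 ≤ U ω} := integral_indicator_one hB

end Moments

/-! ### Split counts of a centered tree -/

section CenteredTree

variable {d : ℕ} {Ω : Type*} [MeasurableSpace Ω] {μ : Measure Ω}
  {D : ℕ → Ω → Fin d} {S : ℕ → Ω → ℝ}

lemma IsCenteredTree.ae_split_eq (h : IsCenteredTree μ D S) :
    ∀ᵐ ω ∂μ, ∀ i, S i ω = 1 / 2 := ae_all_iff.2 h.split_half

variable [IsProbabilityMeasure μ]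

lemma IsCenteredTree.integral_dir (h : IsCenteredTree μ D S) (φ : Fin d → ℝ) (i : ℕ) :
    ∫ ω, φ (D i ω) ∂μ = (∑ k, φ k) / d := by
  have hD := h.measurable_dir i
  have := Measure.isProbabilityMeasure_map (μ := μ) hD.aemeasurable
  rw [← integral_map (φ := D i) (f := φ) hD.aemeasurable
    (measurable_of_countable φ).aestronglyMeasurable, integral_fintype .of_finite,
    Finset.sum_div]
  refine Finset.sum_congr rfl fun k _ => ?_
  rw [measureReal_def, Measure.map_apply hD (MeasurableSet.singleton k), h.uniform_dir]
  simp
  ring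

/-- The increment of the difference of two split counts. -/
def dirDiff {d : ℕ} (k l j : Fin d) : ℝ := (if j = k then 1 else 0) - (if j = l then 1 else 0)

lemma sum_dirDiff_pow {k l : Fin d} (hkl : k ≠ l) (p : ℕ) (hp : p ≠ 0) :
    ∑ j, dirDiff k l j ^ p = 1 + (-1) ^ p := by
  have : ∀ j, dirDiff k l j ^ p = (if j = k then 1 else 0) + (if j = l then (-1) ^ p else 0) := by
    intro j
    unfold dirDiff
    by_cases h1 : j = k
    · subst h1; simp [hkl]
    · by_cases h2 : j = l <;> simp [h1, h2, hp]
      subst h2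
      simp [h1]
  simp [this, Finset.sum_add_distrib]

lemma abs_dirDiff_le (k l j : Fin d) : |dirDiff k l j| ≤ 1 := by
  unfold dirDiff
  split_ifs <;> simp

lemma sum_dirDiff (D : ℕ → Fin d) (k l : Fin d) (N : ℕ) :
    ∑ i ∈ Finset.range N, dirDiff k l (D i) = splitCount D N k - splitCount D N l := by
  simp [dirDiff, splitCount]

lemma IsCenteredTree.measureReal_sq_splitCount_sub_ge (h : IsCenteredTree μ D S) {k l : Fin d}
    (hkl : k ≠ l) {N : ℕ} (hN : d ≤ N) :
    1 / 14 ≤ μ.real {ω | (N : ℝ) / d ≤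
      ((splitCount (fun i => D i ω) N k : ℝ) - splitCount (fun i => D i ω) N l) ^ 2} := by
  have hφ : Measurable (dirDiff k l) := measurable_of_countable _
  set ξ : ℕ → Ω → ℝ := fun i ω => dirDiff k l (D i ω) with hξ
  have hm : ∀ i, Measurable (ξ i) := fun i => hφ.comp (h.measurable_dir i)
  have hind : iIndepFun ξ μ := h.indep_dir.comp (fun _ => dirDiff k l) fun _ => hφ
  have hb : ∀ i ω, |ξ i ω| ≤ 1 := fun i ω => abs_dirDiff_le _ _ _
  have hp : ∀ p ≠ 0, ∀ i, ∫ ω, ξ i ω ^ p ∂μ = (1 + (-1) ^ p) / d := fun p hp i => by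
    rw [h.integral_dir (fun j => dirDiff k l j ^ p) i, sum_dirDiff_pow hkl p hp]
  have h1 : ∀ i, ∫ ω, ξ i ω ∂μ = 0 := fun i => by simpa using hp 1 one_ne_zero i
  have h2 : ∀ i, ∫ ω, ξ i ω ^ 2 ∂μ = 2 / d := fun i => by rw [hp 2 two_ne_zero i]; norm_num
  have h3 : ∀ i, ∫ ω, ξ i ω ^ 3 ∂μ = 0 := fun i => by rw [hp 3 three_ne_zero i]; norm_num
  have h4 : ∀ i, ∫ ω, ξ i ω ^ 4 ∂μ = 2 / d := fun i => by rw [hp 4 four_ne_zero i]; norm_num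
  have hE2 := integral_walk_sq hm hind hb h1 h2 N
  have hE4 := integral_walk_pow_four hm hind hb h1 h2 h3 h4 N
  have hI := integrable_walk_pow_mul_step_pow (μ := μ) hm hb N
  have hd : 0 < d := k.pos
  have hd0 : (0 : ℝ) < d := by exact_mod_cast hd
  have hr : 1 ≤ (N : ℝ) / d := by
    rw [le_div_iff₀ hd0]
    simpa using (by exact_mod_cast hN : (d : ℝ) ≤ N)
  set r : ℝ := (N : ℝ) / d with hr_def
  -- With mean `2r` and second moment at most `14 r^2`, the optimal parameter is `s = 1/(14r)`, and
  -- the bound becomes `1/7 - 1/14 = 1/14`.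
  have hPZ := measureReal_half_le_ge (μ := μ) (U := fun ω => (∑ i ∈ Finset.range N, ξ i ω) ^ 2)
    (by fun_prop) (fun ω => sq_nonneg _) (by simpa using hI 2 0)
    (by simpa [← pow_mul] using hI 4 0) (s := 1 / (14 * r)) (by positivity)
  have e4 : ∀ ω, ((∑ i ∈ Finset.range N, ξ i ω) ^ 2) ^ 2 = (∑ i ∈ Finset.range N, ξ i ω) ^ 4 :=
    fun ω => by rw [← pow_mul]
  simp only [e4, hE2, hE4] at hPZ
  have hv : (N : ℝ) * (2 / d) = 2 * r := by rw [hr_def]; ring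
  -- Here `d ≤ N` enters: `r ≥ 1` gives `2r ≤ 2r^2`.
  have hK : (N : ℝ) * (2 / d) + 3 * N * (N - 1) * (2 / d) ^ 2 ≤ 14 * r ^ 2 := by
    have : (N : ℝ) * (2 / d) + 3 * N * (N - 1) * (2 / d) ^ 2
        = 2 * r + 12 * r ^ 2 - 12 * r / d := by
      rw [hr_def]; field_simp; ring
    have h5 : 0 ≤ 12 * r / d := by positivity
    nlinarith
  have hset : {ω | (N : ℝ) * (2 / d) / 2 ≤ (∑ i ∈ Finset.range N, ξ i ω) ^ 2} = {ω | r ≤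
      ((splitCount (fun i => D i ω) N k : ℝ) - splitCount (fun i => D i ω) N l) ^ 2} := by
    ext ω
    simp only [Set.mem_ofPred_eq, ← sum_dirDiff, hξ, hv]
    rw [mul_div_cancel_left₀ _ (two_ne_zero' ℝ)]
  rw [hset, hv] at hPZ
  rw [hv] at hK
  refine le_trans ?_ hPZ
  have h6 : (1 / (14 * r)) ^ 2 * (2 * r + 3 * N * (N - 1) * (2 / d) ^ 2) ≤
      (1 / (14 * r)) ^ 2 * (14 * r ^ 2) := by gcongr
  have h7 : (1 / (14 * r)) ^ 2 * (14 * r ^ 2) = 1 / 14 := by field_simp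
  have h8 : 1 / (14 * r) * (2 * r) = 1 / 7 := by field_simp; norm_num
  rw [h8]
  linarith

lemma two_pow_le_maxSide_div_minSide {x : Covariate d} (hx : x ∈ unitCube d) {δ : ℕ → Fin d}
    {s : ℕ → ℝ} (hs : ∀ i, s i = 1 / 2) {N : ℕ} {k l : Fin d} {r : ℝ}
    (h : r ≤ ((splitCount δ N k : ℝ) - splitCount δ N l) ^ 2) :
    (2 : ℝ) ^ Real.sqrt r ≤ maxSide (treeCell x δ s N) / minSide (treeCell x δ s N) := by
  wlog hle : splitCount δ N k ≤ splitCount δ N l generalizing k l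
  · exact this (k := l) (l := k) (by rwa [sub_sq_comm]) (by omega)
  have : Nonempty (Fin d) := ⟨k⟩
  have hmax : sideLength (treeCell x δ s N) k ≤ maxSide (treeCell x δ s N) :=
    le_ciSup (f := fun k => sideLength (treeCell x δ s N) k) (Set.finite_range _).bddAbove k
  have hmin : minSide (treeCell x δ s N) ≤ sideLength (treeCell x δ s N) l :=
    ciInf_le (f := fun k => sideLength (treeCell x δ s N) k) (Set.finite_range _).bddBelow l
  have hpos : 0 < minSide (treeCell x δ s N) := by
    obtain ⟨j, hj⟩ := exists_eq_ciInf_of_finite (f := fun k => sideLength (treeCell x δ s N) k)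
    rw [minSide, ← hj]
    simp only [sideLength_treeCell hs hx]
    positivity
  rw [sideLength_treeCell hs hx] at hmax hmin
  calc (2 : ℝ) ^ Real.sqrt r ≤ (2 : ℝ) ^ ((splitCount δ N l - splitCount δ N k : ℕ) : ℝ) := by
        refine Real.rpow_le_rpow_of_exponent_le one_le_two ?_
        rw [Nat.cast_sub hle]
        refine Real.sqrt_le_iff.2 ⟨?_, by rwa [sub_sq_comm]⟩
        have : (splitCount δ N k : ℝ) ≤ splitCount δ N l := by exact_mod_cast hle
        linarith
    _ = (1 / 2) ^ splitCount δ N k / (1 / 2) ^ splitCount δ N l := by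
        rw [Real.rpow_natCast, pow_sub₀ _ two_ne_zero hle]
        simp
        ring
    _ ≤ _ := div_le_div₀ (le_trans (by positivity) hmax) hmax hpos hmin

lemma IsCenteredTree.measure_side_ratio_ge (h : IsCenteredTree μ D S) (hd : 2 ≤ d)
    {x : Covariate d} (hx : x ∈ unitCube d) {N : ℕ} (hN : d ≤ N) :
    (1 / 14 : ℝ≥0∞) ≤ μ {ω | (2 : ℝ) ^ Real.sqrt ((N : ℝ) / d) ≤
      maxSide (treeCell x (fun i => D i ω) (fun i => S i ω) N) /
        minSide (treeCell x (fun i => D i ω) (fun i => S i ω) N)} := by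
  have hkl : (⟨0, by omega⟩ : Fin d) ≠ ⟨1, by omega⟩ := by simp
  have h1 := h.measureReal_sq_splitCount_sub_ge hkl hN
  have h2 := ENNReal.ofReal_le_ofReal h1
  rw [ofReal_measureReal, ENNReal.ofReal_div_of_pos (by norm_num)] at h2
  simp only [ENNReal.ofReal_one, ENNReal.ofReal_ofNat] at h2
  refine h2.trans (measure_mono_ae ?_)
  filter_upwards [h.ae_split_eq] with ω hω hmem
  exact two_pow_le_maxSide_div_minSide hx hω hmem

end CenteredTree

/-! ### Concentration for the sample points in a fixed cell -/

section Regression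

variable {d : ℕ} {P : Measure (Covariate d × ℝ)} {g : Covariate d → ℝ} {b σ : ℝ}

lemma DensityBoundedBelow.ae_mem_unitCube (h : DensityBoundedBelow P b) :
    ∀ᵐ z ∂P, z.1 ∈ unitCube d := by
  obtain ⟨f, -, -, hf⟩ := h
  refine ae_of_ae_map (p := fun y => y ∈ unitCube d) measurable_fst.aemeasurable ?_
  rw [hf]
  exact (withDensity_absolutelyContinuous _ _).ae_le (ae_restrict_mem (measurableSet_unitCube d))

lemma DensityBoundedBelow.le_measure_preimage (h : DensityBoundedBelow P b) {V : Set (Covariate d)}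
    (hV : MeasurableSet V) (hVc : V ⊆ unitCube d) :
    ENNReal.ofReal b * volume V ≤ P (Prod.fst ⁻¹' V) := by
  obtain ⟨f, -, hb, hf⟩ := h
  rw [← Measure.map_apply measurable_fst hV, hf, withDensity_apply _ hV,
    Measure.restrict_restrict hV, Set.inter_eq_left.2 hVc]
  calc ENNReal.ofReal b * volume V = ∫⁻ _ in V, ENNReal.ofReal b := by simp
    _ ≤ _ := setLIntegral_mono' hV fun z hz => ENNReal.ofReal_le_ofReal (hb z (hVc hz))

/-- Serves to exchange `g` for a Lipschitz extension from the cube, which is measurable on the whole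
space. -/
lemma SubGaussianNoise.congr (h : SubGaussianNoise P g σ) {g' : Covariate d → ℝ}
    (hg : ∀ᵐ z ∂P, g z.1 = g' z.1) : SubGaussianNoise P g' σ := by
  obtain ⟨h1, h2, h3⟩ := h
  have e1 : (fun z : Covariate d × ℝ => z.2 - g z.1) =ᵐ[P] fun z => z.2 - g' z.1 := by
    filter_upwards [hg] with z hz using by rw [hz]
  have e2 : ∀ t : ℝ, (fun z : Covariate d × ℝ => Real.exp (t * (z.2 - g z.1))) =ᵐ[P]
      fun z => Real.exp (t * (z.2 - g' z.1)) := fun t => by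
    filter_upwards [hg] with z hz using by rw [hz]
  refine ⟨h1.congr e1, (condExp_congr_ae e1).symm.trans h2, fun t => ⟨(h3 t).1.congr (e2 t), ?_⟩⟩
  exact (condExp_congr_ae (e2 t)).symm.trans_le (h3 t).2

/-- The exponent whose exponential has mean at most `1` under sub-Gaussian noise. -/
noncomputable def tiltedNoise {d : ℕ} (g : Covariate d → ℝ) (σ t : ℝ) (V : Set (Covariate d)) :
    Covariate d × ℝ → ℝ :=
  (Prod.fst ⁻¹' V).indicator fun z => t * (z.2 - g z.1) - σ ^ 2 * t ^ 2 / 2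

lemma measurable_tiltedNoise (hg : Measurable g) (t : ℝ) {V : Set (Covariate d)}
    (hV : MeasurableSet V) : Measurable (tiltedNoise g σ t V) :=
  Measurable.indicator (by fun_prop) (measurable_fst hV)

lemma exp_tiltedNoise (t : ℝ) (V : Set (Covariate d)) (z : Covariate d × ℝ) :
    Real.exp (tiltedNoise g σ t V z) =
      (Prod.fst ⁻¹' V)ᶜ.indicator (fun _ => (1 : ℝ)) z + Real.exp (-(σ ^ 2 * t ^ 2 / 2)) *
        (Prod.fst ⁻¹' V).indicator (fun z => Real.exp (t * (z.2 - g z.1))) z := by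
  by_cases hz : z ∈ Prod.fst ⁻¹' V
  · rw [tiltedNoise, Set.indicator_of_mem hz, Set.indicator_of_mem hz,
      Set.indicator_of_notMem (by simpa using hz), ← Real.exp_add]
    ring_nf
  · rw [tiltedNoise, Set.indicator_of_notMem hz, Set.indicator_of_notMem hz,
      Set.indicator_of_mem (by simpa using hz)]
    simp

variable {Ω : Type*} [MeasurableSpace Ω] {μ : Measure Ω} {Z : ℕ → Ω → Covariate d × ℝ}

/-- Chernoff's bound at parameter `1`, the scale being absorbed in `φ`; it is used for both the
counts and the noise. -/
lemma IsSample.measureReal_le_sum_le [IsProbabilityMeasure μ] (h : IsSample μ P Z)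
    {φ : Covariate d × ℝ → ℝ} (hφ : Measurable φ) (hI : Integrable (fun z => Real.exp (φ z)) P)
    {a : ℝ} (ha : ∫ z, Real.exp (φ z) ∂P ≤ a) (n : ℕ) (s : ℝ) :
    μ.real {ω | s ≤ ∑ i ∈ Finset.range n, φ (Z i ω)} ≤ Real.exp (-s) * a ^ n := by
  have hind : iIndepFun (fun i ω => φ (Z i ω)) μ := h.indep_pair.comp (fun _ => φ) fun _ => hφ
  have hm : ∀ i, Measurable fun ω => φ (Z i ω) := fun i => hφ.comp (h.measurable_pair i)
  have hint : ∀ i, Integrable (fun ω => Real.exp (1 * φ (Z i ω))) μ := fun i => by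
    rw [← h.law_pair i] at hI
    simpa [Function.comp_def] using hI.comp_measurable (h.measurable_pair i)
  have hmgf : ∀ i, mgf (fun ω => φ (Z i ω)) μ 1 ≤ a := fun i => by
    refine le_of_eq_of_le ?_ ha
    rw [← h.law_pair i, integral_map (h.measurable_pair i).aemeasurable
      (Measurable.aestronglyMeasurable (by fun_prop))]
    simp [mgf]
  have key := measure_ge_le_exp_mul_mgf (X := ∑ i ∈ Finset.range n, fun ω => φ (Z i ω)) s
    zero_le_one (hind.integrable_exp_mul_sum (s := Finset.range n) hm fun i _ => hint i)
  rw [hind.mgf_sum hm] at key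
  simp only [Finset.sum_apply, neg_mul, one_mul] at key
  refine key.trans (mul_le_mul_of_nonneg_left ?_ (Real.exp_pos _).le)
  refine (Finset.prod_le_prod (fun i _ => mgf_nonneg) fun i _ => hmgf i).trans_eq (by simp)

variable [IsProbabilityMeasure P]

lemma SubGaussianNoise.integrable_exp_tiltedNoise (h : SubGaussianNoise P g σ) (t : ℝ)
    {V : Set (Covariate d)} (hV : MeasurableSet V) :
    Integrable (fun z => Real.exp (tiltedNoise g σ t V z)) P := by
  simp_rw [exp_tiltedNoise]
  exact ((integrable_const _).indicator (measurable_fst hV).compl).add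
    (((h.2.2 t).1.indicator (measurable_fst hV)).const_mul _)

/-- The event `X ∈ V` belongs to `covariateSigma`, so the conditional bound integrates over it: its
contribution is at most its probability, and the complement contributes exactly its own. -/
lemma SubGaussianNoise.integral_exp_tiltedNoise_le (h : SubGaussianNoise P g σ) (t : ℝ)
    {V : Set (Covariate d)} (hV : MeasurableSet V) :
    ∫ z, Real.exp (tiltedNoise g σ t V z) ∂P ≤ 1 := by
  have hVm : MeasurableSet (Prod.fst ⁻¹' V : Set (Covariate d × ℝ)) := measurable_fst hV
  have hm : covariateSigma d ≤ (inferInstance : MeasurableSpace (Covariate d × ℝ)) :=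
    measurable_fst.comap_le
  have hset : ∫ z in Prod.fst ⁻¹' V, Real.exp (t * (z.2 - g z.1)) ∂P ≤
      Real.exp (σ ^ 2 * t ^ 2 / 2) * P.real (Prod.fst ⁻¹' V) := by
    rw [← setIntegral_condExp hm (h.2.2 t).1 ⟨V, hV, rfl⟩]
    refine (setIntegral_mono_ae integrable_condExp.integrableOn
      (integrable_const (Real.exp (σ ^ 2 * t ^ 2 / 2))).integrableOn (h.2.2 t).2).trans_eq ?_
    simp [mul_comm]
  simp_rw [exp_tiltedNoise]
  rw [integral_add ((integrable_const _).indicator hVm.compl)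
      (((h.2.2 t).1.indicator hVm).const_mul _), integral_const_mul, integral_indicator hVm,
    integral_indicator hVm.compl, setIntegral_const, measureReal_compl hVm]
  have := mul_le_mul_of_nonneg_left hset (Real.exp_pos (-(σ ^ 2 * t ^ 2 / 2))).le
  rw [← mul_assoc, ← Real.exp_add, neg_add_cancel, Real.exp_zero, one_mul] at this
  simp only [probReal_univ, smul_eq_mul, mul_one]
  linarith

end Regression

section Cell

open Classical in
/-- The number of the first `n` covariates that lie in `V`. -/
noncomputable def cellCount {d : ℕ} (n : ℕ) (V : Set (Covariate d)) (Z : ℕ → Covariate d × ℝ) : ℝ :=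
  ∑ i ∈ Finset.range n, if (Z i).1 ∈ V then (1 : ℝ) else 0

open Classical in
/-- The sum of the noise over those of the first `n` observations whose covariate lies in `V`. -/
noncomputable def cellNoise {d : ℕ} (g : Covariate d → ℝ) (n : ℕ) (V : Set (Covariate d))
    (Z : ℕ → Covariate d × ℝ) : ℝ :=
  ∑ i ∈ Finset.range n, if (Z i).1 ∈ V then (Z i).2 - g (Z i).1 else 0

variable {d : ℕ} {g : Covariate d → ℝ} {b σ : ℝ} {V : Set (Covariate d)}

lemma measurable_cellCount (n : ℕ) (hV : MeasurableSet V) : Measurable (cellCount n V) := by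
  classical
  unfold cellCount
  refine Finset.measurable_sum _ fun i _ => Measurable.ite ?_ measurable_const measurable_const
  exact (measurable_fst.comp (measurable_pi_apply i)) hV

lemma measurable_cellNoise (hg : Measurable g) (n : ℕ) (hV : MeasurableSet V) :
    Measurable (cellNoise g n V) := by
  classical
  unfold cellNoise
  refine Finset.measurable_sum _ fun i _ => Measurable.ite ?_ (by fun_prop) measurable_const
  exact (measurable_fst.comp (measurable_pi_apply i)) hV

lemma sum_tiltedNoise (t : ℝ) (n : ℕ) (Z : ℕ → Covariate d × ℝ) :
    ∑ i ∈ Finset.range n, tiltedNoise g σ t V (Z i) =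
      t * cellNoise g n V Z - σ ^ 2 * t ^ 2 / 2 * cellCount n V Z := by
  classical
  rw [cellNoise, cellCount, Finset.mul_sum, Finset.mul_sum, ← Finset.sum_sub_distrib]
  refine Finset.sum_congr rfl fun i _ => ?_
  by_cases h : (Z i).1 ∈ V <;> simp [tiltedNoise, h]

/-- Decomposition of the error of a local average into bias and noise. -/
lemma abs_localAverage_sub_le {n : ℕ} {Z : ℕ → Covariate d × ℝ} {y β η : ℝ}
    (hpos : 0 < cellCount n V Z) (hbias : ∀ z ∈ V, |g z - y| ≤ β)
    (hnoise : |cellNoise g n V Z| ≤ η * cellCount n V Z) :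
    |localAverage n V Z - y| ≤ β + η := by
  classical
  have hdec : localAverage n V Z - y = (cellNoise g n V Z +
      ∑ i ∈ Finset.range n, if (Z i).1 ∈ V then g (Z i).1 - y else 0) / cellCount n V Z := by
    rw [eq_div_iff hpos.ne', sub_mul, localAverage]
    change _ / cellCount n V Z * _ - _ = _
    rw [div_mul_cancel₀ _ hpos.ne', cellNoise, cellCount, Finset.mul_sum,
      ← Finset.sum_sub_distrib, ← Finset.sum_add_distrib]
    refine Finset.sum_congr rfl fun i _ => ?_
    by_cases h : (Z i).1 ∈ V <;> simp [h]
  have hb : |∑ i ∈ Finset.range n, if (Z i).1 ∈ V then g (Z i).1 - y else 0| ≤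
      β * cellCount n V Z := by
    rw [cellCount, Finset.mul_sum]
    refine (Finset.abs_sum_le_sum_abs _ _).trans (Finset.sum_le_sum fun i _ => ?_)
    by_cases h : (Z i).1 ∈ V
    · simpa [h] using hbias _ h
    · simp [h]
  rw [hdec, abs_div, abs_of_pos hpos, div_le_iff₀ hpos, add_mul]
  exact (abs_add_le _ _).trans (by linarith)

variable {P : Measure (Covariate d × ℝ)} [IsProbabilityMeasure P]
  {Ω : Type*} [MeasurableSpace Ω] {μ : Measure Ω} [IsProbabilityMeasure μ]
  {Z : ℕ → Ω → Covariate d × ℝ}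

lemma IsSample.measureReal_cellCount_le (h : IsSample μ P Z) (hV : MeasurableSet V) (n : ℕ) :
    μ.real {ω | cellCount n V (fun i => Z i ω) ≤ n * P.real (Prod.fst ⁻¹' V) / 4} ≤
      Real.exp (-(n * P.real (Prod.fst ⁻¹' V) / 4)) := by
  classical
  have hVm : MeasurableSet (Prod.fst ⁻¹' V : Set (Covariate d × ℝ)) := measurable_fst hV
  set p := P.real (Prod.fst ⁻¹' V) with hp
  set φ : Covariate d × ℝ → ℝ := (Prod.fst ⁻¹' V).indicator fun _ => -1 with hφ
  have hφm : Measurable φ := measurable_const.indicator hVm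
  have he : ∀ z, Real.exp (φ z) = 1 - (Prod.fst ⁻¹' V).indicator
      (fun _ => 1 - Real.exp (-1)) z := by
    intro z
    by_cases hz : z ∈ Prod.fst ⁻¹' V
    · simp only [hφ, Set.indicator_of_mem hz]; ring
    · simp only [hφ, Set.indicator_of_notMem hz]; simp
  have hI1 : Integrable ((Prod.fst ⁻¹' V).indicator
      (fun _ : Covariate d × ℝ => 1 - Real.exp (-1))) P := (integrable_const _).indicator hVm
  have hI : Integrable (fun z => Real.exp (φ z)) P := by
    simp_rw [he]
    exact (integrable_const _).sub hI1
  have hexp : Real.exp (-1) ≤ 1 / 2 := by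
    rw [Real.exp_neg, ← one_div]
    exact one_div_le_one_div_of_le two_pos (by linarith [Real.add_one_le_exp (1 : ℝ)])
  -- The mean is `1 - p(1 - 1/e) ≤ 1 - p/2 ≤ e^(-p/2)`; the threshold `np/4` uses up half of the
  -- exponent `np/2`.
  have ha : ∫ z, Real.exp (φ z) ∂P ≤ Real.exp (-(p / 2)) := by
    simp_rw [he]
    rw [integral_sub (integrable_const _) hI1, integral_indicator hVm, setIntegral_const]
    simp only [integral_const, probReal_univ, smul_eq_mul, one_mul, ← hp]
    have h1 : 0 ≤ p := measureReal_nonneg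
    have h2 := Real.add_one_le_exp (-(p / 2))
    nlinarith
  have key := h.measureReal_le_sum_le hφm hI ha n (-(n * p / 4))
  have hsum : ∀ ω, ∑ i ∈ Finset.range n, φ (Z i ω) = -cellCount n V (fun i => Z i ω) := by
    intro ω
    rw [cellCount, ← Finset.sum_neg_distrib]
    refine Finset.sum_congr rfl fun i _ => ?_
    by_cases hz : (Z i ω).1 ∈ V <;> simp [hφ, hz]
  simp only [hsum, neg_le_neg_iff] at key
  refine key.trans_eq ?_
  rw [← Real.exp_nat_mul, ← Real.exp_add]
  ring_nf

/-- The threshold contains the random count itself, so no conditioning on the covariates is needed;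
the signs `t` and `-t` give the factor `2`. -/
lemma IsSample.measureReal_cellNoise_ge (h : IsSample μ P Z) (hg : Measurable g)
    (hsg : SubGaussianNoise P g σ) (hV : MeasurableSet V) (n : ℕ) (t s : ℝ) :
    μ.real {ω | s + σ ^ 2 * t ^ 2 / 2 * cellCount n V (fun i => Z i ω) ≤
      |t * cellNoise g n V (fun i => Z i ω)|} ≤ 2 * Real.exp (-s) := by
  have key : ∀ t, μ.real {ω | s ≤ t * cellNoise g n V (fun i => Z i ω) -
      σ ^ 2 * t ^ 2 / 2 * cellCount n V (fun i => Z i ω)} ≤ Real.exp (-s) := by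
    intro t
    have := h.measureReal_le_sum_le (measurable_tiltedNoise hg t hV)
      (hsg.integrable_exp_tiltedNoise t hV) (hsg.integral_exp_tiltedNoise_le t hV) n s
    simpa only [sum_tiltedNoise, one_pow, mul_one] using this
  calc _ ≤ μ.real ({ω | s ≤ t * cellNoise g n V (fun i => Z i ω) -
        σ ^ 2 * t ^ 2 / 2 * cellCount n V (fun i => Z i ω)} ∪
        {ω | s ≤ -t * cellNoise g n V (fun i => Z i ω) -
        σ ^ 2 * (-t) ^ 2 / 2 * cellCount n V (fun i => Z i ω)}) := by
        refine measureReal_mono fun ω hω => ?_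
        rw [Set.mem_ofPred_eq, le_abs] at hω
        rcases hω with h1 | h1
        · exact Or.inl (show s ≤ _ by linarith)
        · refine Or.inr (show s ≤ _ from ?_)
          rw [neg_sq]
          linarith
    _ ≤ _ := measureReal_union_le _ _
    _ ≤ 2 * Real.exp (-s) := by linarith [key t, key (-t)]

end Cell

/-! ### Randomness of the tree -/

/-- Conditioning on a discrete variable: the weights of the values of `T` sum to one, so a bound
uniform in the value passes to the random set without loss. -/
lemma IndepFun.measure_preimage_le_of_forall {Ω τ β : Type*} [MeasurableSpace Ω]
    [MeasurableSpace τ] [Countable τ] [MeasurableSingletonClass τ] [MeasurableSpace β]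
    {μ : Measure Ω} [IsProbabilityMeasure μ] {T : Ω → τ} {W : Ω → β} (h : IndepFun T W μ)
    (hT : Measurable T) {B : τ → Set β} (hB : ∀ v, MeasurableSet (B v)) {c : ℝ≥0∞}
    (hc : ∀ v, μ (W ⁻¹' B v) ≤ c) : μ {ω | W ω ∈ B (T ω)} ≤ c := by
  calc μ {ω | W ω ∈ B (T ω)} ≤ μ (⋃ v, T ⁻¹' {v} ∩ W ⁻¹' B v) :=
        measure_mono fun ω hω => Set.mem_iUnion.2 ⟨T ω, rfl, hω⟩
    _ ≤ ∑' v, μ (T ⁻¹' {v} ∩ W ⁻¹' B v) := measure_iUnion_le _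
    _ ≤ ∑' v, μ (T ⁻¹' {v}) * c := by
        refine ENNReal.tsum_le_tsum fun v => ?_
        rw [h.measure_inter_preimage_eq_mul _ _ (MeasurableSet.singleton v) (hB v)]
        gcongr
        exact hc v
    _ = (∑' v, μ (T ⁻¹' {v})) * c := ENNReal.tsum_mul_right
    _ = c := by
        rw [← measure_iUnion (fun v w hvw => (Set.disjoint_singleton.2 hvw).preimage T)
          fun v => hT (MeasurableSet.singleton v), ← Set.preimage_iUnion, Set.iUnion_of_singleton,
          Set.preimage_univ, measure_univ, one_mul]

section RandomTree

variable {d : ℕ} {Ω : Type*} [MeasurableSpace Ω] {μ : Measure Ω} [IsProbabilityMeasure μ]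
  {D : ℕ → Ω → Fin d} {S : ℕ → Ω → ℝ}

/-- Hoeffding's inequality for the split counts. -/
lemma IsCenteredTree.measureReal_splitCount_le (h : IsCenteredTree μ D S) (k : Fin d) {N : ℕ}
    (hN : 1 ≤ N) : μ.real {ω | (splitCount (fun i => D i ω) N k : ℝ) ≤
      N / d - Real.sqrt (N * Real.log N)} ≤ 1 / (N : ℝ) ^ 2 := by
  have hd0 : (0 : ℝ) < d := by exact_mod_cast k.pos
  have hN0 : (0 : ℝ) < N := by exact_mod_cast hN
  set φ : Fin d → ℝ := fun j => 1 / d - if j = k then 1 else 0 with hφ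
  have hφm : Measurable φ := measurable_of_countable _
  have hind : iIndepFun (fun i ω => φ (D i ω)) μ := h.indep_dir.comp (fun _ => φ) fun _ => hφm
  have hsub : ∀ i < N, HasSubgaussianMGF (fun ω => φ (D i ω))
      ((‖(1 / d : ℝ) - (1 / d - 1)‖₊ / 2) ^ 2) μ := by
    intro i _
    refine hasSubgaussianMGF_of_mem_Icc_of_integral_eq_zero
      (hφm.comp (h.measurable_dir i)).aemeasurable
      (Filter.Eventually.of_forall fun ω => ?_) ?_
    · simp only [hφ]
      split_ifs <;> constructor <;> linarith
    · rw [h.integral_dir φ i]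
      simp [hφ, hd0.ne']
  have key := HasSubgaussianMGF.measure_sum_range_ge_le_of_iIndepFun hind hsub
    (Real.sqrt_nonneg (N * Real.log N))
  have hset : {ω | (splitCount (fun i => D i ω) N k : ℝ) ≤ N / d - Real.sqrt (N * Real.log N)} =
      {ω | Real.sqrt (N * Real.log N) ≤ ∑ i ∈ Finset.range N, φ (D i ω)} := by
    ext ω
    have : ∑ i ∈ Finset.range N, φ (D i ω) = N / d - splitCount (fun i => D i ω) N k := by
      simp [hφ, splitCount, div_eq_mul_inv]
    simp only [Set.mem_ofPred_eq, this]
    constructor <;> intro h <;> linarith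
  rw [hset]
  refine key.trans_eq ?_
  have hlog : 0 ≤ Real.log N := Real.log_natCast_nonneg N
  rw [Real.sq_sqrt (by positivity)]
  -- The steps lie in an interval of length `1`, so the variance proxy is `1/4` and the exponent is
  -- `-2 log N`.
  have e : -(N * Real.log N) / (2 * N * (((‖(1 / d : ℝ) - (1 / d - 1)‖₊ / 2) ^ 2 : ℝ≥0) : ℝ)) =
      -(Real.log ((N : ℝ) ^ 2)) := by
    rw [Real.log_pow]
    simp
    field_simp
  rw [e, Real.exp_neg, Real.exp_log (by positivity), one_div]

lemma IsCenteredTree.ae_eventually_splitCount_ge (h : IsCenteredTree μ D S) :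
    ∀ᵐ ω ∂μ, ∀ᶠ N : ℕ in Filter.atTop, ∀ k,
      N / d - Real.sqrt (N * Real.log N) ≤ (splitCount (fun i => D i ω) N k : ℝ) := by
  simp only [Filter.eventually_all]
  intro k
  -- The guard `1 ≤ N` matters: at `N = 0` the event is certain while the bound `1 / N ^ 2` is `0`
  -- by convention.
  have hsum : (∑' N : ℕ, μ {ω | 1 ≤ N ∧ (splitCount (fun i => D i ω) N k : ℝ) ≤
      N / d - Real.sqrt (N * Real.log N)}) ≠ ∞ := by
    refine ne_top_of_le_ne_top
      (Real.summable_one_div_nat_pow.2 one_lt_two).tsum_ofReal_ne_top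
      (ENNReal.tsum_le_tsum fun N => ?_)
    rcases Nat.eq_zero_or_pos N with rfl | hN
    · simp
    · rw [← ofReal_measureReal]
      exact ENNReal.ofReal_le_ofReal
        ((measureReal_mono fun ω hω => hω.2).trans (h.measureReal_splitCount_le k hN))
  filter_upwards [ae_eventually_notMem hsum] with ω hω
  filter_upwards [hω, Filter.eventually_ge_atTop 1] with N h1 h2
  by_contra! hcon
  exact h1 ⟨h2, hcon.le⟩

variable {P : Measure (Covariate d × ℝ)} [IsProbabilityMeasure P] {g : Covariate d → ℝ} {b σ : ℝ}
  {Z : ℕ → Ω → Covariate d × ℝ}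

/-- The event that a cell with `N` splits has few sample points or large noise. -/
def badCell {d : ℕ} (g : Covariate d → ℝ) (b σ t s : ℝ) (n N : ℕ) (V : Set (Covariate d)) :
    Set (ℕ → Covariate d × ℝ) :=
  {w | cellCount n V w ≤ n * (b * (1 / 2) ^ N) / 4} ∪
    {w | s + σ ^ 2 * t ^ 2 / 2 * cellCount n V w ≤ |t * cellNoise g n V w|}

lemma measurableSet_badCell (hg : Measurable g) (t s : ℝ) (n N : ℕ) {V : Set (Covariate d)}
    (hV : MeasurableSet V) : MeasurableSet (badCell g b σ t s n N V) := by
  have h1 := measurable_cellCount n hV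
  have h2 := measurable_cellNoise hg n hV
  exact (measurableSet_le h1 measurable_const).union
    (measurableSet_le (by fun_prop) (by fun_prop))

lemma IsSample.measure_badCell_le (h : IsSample μ P Z) (hg : Measurable g)
    (hsg : SubGaussianNoise P g σ) (hb : 0 < b) (hdens : DensityBoundedBelow P b)
    (x : Covariate d) (δ : ℕ → Fin d) (t s : ℝ) (n N : ℕ) :
    μ ((fun ω i => Z i ω) ⁻¹' badCell g b σ t s n N (treeCell x δ (fun _ => 1 / 2) N)) ≤
      ENNReal.ofReal (Real.exp (-(n * (b * (1 / 2) ^ N) / 4)) + 2 * Real.exp (-s)) := by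
  set V := treeCell x δ (fun _ => 1 / 2) N with hVdef
  have hV : MeasurableSet V := measurableSet_treeCell N
  have hp : b * (1 / 2) ^ N ≤ P.real (Prod.fst ⁻¹' V) := by
    have h1 := hdens.le_measure_preimage hV (treeCell_subset_unitCube N)
    rw [measureReal_def, ← ENNReal.ofReal_le_iff_le_toReal (measure_ne_top _ _),
      ENNReal.ofReal_mul hb.le]
    refine le_trans ?_ h1
    gcongr
    exact volume_treeCell_ge (fun _ => rfl) N
  rw [← ofReal_measureReal]
  refine ENNReal.ofReal_le_ofReal ?_
  refine (measureReal_union_le _ _).trans (add_le_add ?_ ?_)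
  · calc _ ≤ μ.real {ω | cellCount n V (fun i => Z i ω) ≤
          n * P.real (Prod.fst ⁻¹' V) / 4} := by
          refine measureReal_mono fun ω hω => ?_
          exact le_trans (show cellCount n V (fun i => Z i ω) ≤ _ from hω) (by gcongr)
      _ ≤ _ := h.measureReal_cellCount_le hV n
      _ ≤ _ := by gcongr
  · exact h.measureReal_cellNoise_ge hg hsg hV n t s

lemma IsSample.measure_badCell_random_le (h : IsSample μ P Z) (hg : Measurable g)
    (hsg : SubGaussianNoise P g σ) (hb : 0 < b) (hdens : DensityBoundedBelow P b)
    (htree : IsCenteredTree μ D S)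
    (hind : IndepFun (fun ω i => (D i ω, S i ω)) (fun ω i => Z i ω) μ)
    (hd : 0 < d) (x : Covariate d) (t s : ℝ) (n N : ℕ) :
    μ {ω | (fun i => Z i ω) ∈ badCell g b σ t s n N
        (treeCell x (fun i => D i ω) (fun _ => 1 / 2) N)} ≤
      ENNReal.ofReal (Real.exp (-(n * (b * (1 / 2) ^ N) / 4)) + 2 * Real.exp (-s)) := by
  -- Truncation to `N` directions makes `T` take finitely many values; `e` pads them back to a
  -- sequence, with an arbitrary direction that does not affect the cell.
  set T : Ω → Fin N → Fin d := fun ω i => D i ω with hT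
  set e : (Fin N → Fin d) → ℕ → Fin d := fun v i => if hi : i < N then v ⟨i, hi⟩ else ⟨0, hd⟩
  have hTm : Measurable T := measurable_pi_lambda _ fun i => htree.measurable_dir i
  have hTi : IndepFun T (fun ω i => Z i ω) μ :=
    hind.comp (φ := fun w : ℕ → Fin d × ℝ => fun i : Fin N => (w i).1) (ψ := id)
      (by fun_prop) measurable_id
  have hcell : ∀ ω, treeCell x (fun i => D i ω) (fun _ => (1 / 2 : ℝ)) N =
      treeCell x (e (T ω)) (fun _ => 1 / 2) N := fun ω =>
    treeCell_congr (fun i hi => by simp [e, hT, hi]) fun _ _ => rfl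
  simp_rw [hcell]
  exact IndepFun.measure_preimage_le_of_forall hTi hTm
    (B := fun v => badCell g b σ t s n N (treeCell x (e v) (fun _ => 1 / 2) N))
    (fun v => measurableSet_badCell hg t s n N (measurableSet_treeCell N))
    fun v => h.measure_badCell_le hg hsg hb hdens x (e v) t s n N

end RandomTree

/-! ### Rates -/

section Rates

variable {d : ℕ}

/-- The parametrization of the number of splits by the rate `r = n ^ (-1 / (d + 2))`. -/
lemma half_pow_bounds (hd : 1 ≤ d) {n N : ℕ} (hn : 1 ≤ n)
    (hN : |(N : ℝ) - d * Real.log n / ((d + 2) * Real.log 2)| < 1) :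
    1 / 2 ≤ ((n : ℝ) ^ (-(1 : ℝ) / (d + 2))) ^ 2 * (n * (1 / 2) ^ N) ∧
      (2 : ℝ) ^ (-((N : ℝ) / d)) ≤ 2 * (n : ℝ) ^ (-(1 : ℝ) / (d + 2)) ∧
      (N : ℝ) ≤ Real.log n / Real.log 2 + 1 := by
  have hn0 : (0 : ℝ) < n := by exact_mod_cast hn
  have hd1 : (1 : ℝ) ≤ d := by exact_mod_cast hd
  have hl2 : 0 < Real.log 2 := Real.log_pos one_lt_two
  have hl : 0 ≤ Real.log n := Real.log_natCast_nonneg n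
  obtain ⟨h1, h2⟩ := abs_lt.1 hN
  set ℓ := Real.log n with hℓ
  have hα : d * ℓ / ((d + 2) * Real.log 2) * Real.log 2 = d * ℓ / (d + 2) := by field_simp
  -- Rounding shifts `N log 2` by at most `log 2`; this is the source of the `1/2`, the `2` and the
  -- `+ 1` in the conclusions.
  have hu : N * Real.log 2 ≤ d * ℓ / (d + 2) + Real.log 2 := by
    rw [← hα]; nlinarith
  have hlow : d * ℓ / (d + 2) - Real.log 2 ≤ N * Real.log 2 := by
    rw [← hα]; nlinarith
  have hr : (n : ℝ) ^ (-(1 : ℝ) / (d + 2)) = Real.exp (-(ℓ / (d + 2))) := by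
    rw [Real.rpow_def_of_pos hn0, ← hℓ]; ring_nf
  have hhalf : (1 / 2 : ℝ) = Real.exp (-Real.log 2) := by
    rw [Real.exp_neg, Real.exp_log two_pos, one_div]
  refine ⟨?_, ?_, ?_⟩
  · have hnexp : (n : ℝ) = Real.exp ℓ := (Real.exp_log hn0).symm
    rw [hr, hhalf, hnexp, ← Real.exp_nat_mul, ← Real.exp_nat_mul, ← Real.exp_add, ← Real.exp_add]
    refine Real.exp_le_exp.2 ?_
    have : d * ℓ / (d + 2) = ℓ - 2 * (ℓ / (d + 2)) := by field_simp; ring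
    push_cast
    linarith
  · have h2exp : (2 : ℝ) = Real.exp (Real.log 2) := (Real.exp_log two_pos).symm
    rw [hr, Real.rpow_def_of_pos two_pos]
    nth_rw 2 [h2exp]
    rw [← Real.exp_add]
    refine Real.exp_le_exp.2 ?_
    have h3 : d * ℓ / (d + 2) / d = ℓ / (d + 2) := by field_simp
    have h4 : (d * ℓ / (d + 2) - Real.log 2) / d ≤ N * Real.log 2 / d := by gcongr
    have h5 : Real.log 2 / d ≤ Real.log 2 := div_le_self hl2.le hd1
    rw [sub_div, h3] at h4
    have h6 : Real.log 2 * -((N : ℝ) / d) = -(N * Real.log 2 / d) := by ring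
    rw [h6]
    linarith
  · have h3 : d * ℓ / (d + 2) ≤ ℓ := by
      rw [div_le_iff₀ (by positivity)]; nlinarith
    rw [← sub_le_iff_le_add, le_div_iff₀ hl2]
    linarith

/-- The logarithmic fluctuation of the split counts is absorbed by the correction factor. -/
lemma two_rpow_sqrt_le {ℓ : ℝ} (hℓ : 2 ≤ ℓ) {N : ℕ} (hN : (N : ℝ) ≤ ℓ / Real.log 2 + 1) :
    (2 : ℝ) ^ Real.sqrt (N * Real.log N) ≤ Real.exp (2 * Real.sqrt (ℓ * Real.log ℓ)) := by
  have hl2 : 0.6 < Real.log 2 := lt_trans (by norm_num) Real.log_two_gt_d9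
  have hl2' : Real.log 2 < 1 := lt_trans Real.log_two_lt_d9 (by norm_num)
  have hlog : 0 ≤ Real.log ℓ := Real.log_nonneg (by linarith)
  have h1 : (N : ℝ) ≤ 2 * ℓ := by
    have : ℓ / Real.log 2 + 1 ≤ 2 * ℓ := by
      rw [div_add_one (by linarith), div_le_iff₀ (by linarith)]
      nlinarith [Real.log_two_gt_d9]
    linarith
  have h2 : Real.log N ≤ 2 * Real.log ℓ := by
    rcases Nat.eq_zero_or_pos N with rfl | hpos
    · simpa using hlog
    · have hN0 : (0 : ℝ) < N := by exact_mod_cast hpos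
      calc Real.log N ≤ Real.log (ℓ ^ 2) := Real.log_le_log hN0 (by nlinarith)
        _ = 2 * Real.log ℓ := by rw [Real.log_pow]; norm_num
  -- From `N ≤ 2ℓ` and `N ≤ ℓ^2`, both due to `ℓ ≥ 2`, one gets `N log N ≤ 4 ℓ log ℓ`; the remaining
  -- factor `log 2 < 1` is dropped.
  have h3 : Real.sqrt (N * Real.log N) ≤ 2 * Real.sqrt (ℓ * Real.log ℓ) := by
    rw [Real.sqrt_le_iff]
    refine ⟨by positivity, ?_⟩
    rw [mul_pow, Real.sq_sqrt (by positivity)]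
    calc (N : ℝ) * Real.log N ≤ (2 * ℓ) * (2 * Real.log ℓ) :=
          mul_le_mul h1 h2 (Real.log_natCast_nonneg N) (by positivity)
      _ = _ := by ring
  rw [Real.rpow_def_of_pos two_pos]
  refine Real.exp_le_exp.2 ((mul_le_of_le_one_left (Real.sqrt_nonneg _) hl2'.le).trans h3)

lemma sqrt_le_exp_two_mul_sqrt {ℓ : ℝ} (hℓ : Real.exp 1 ≤ ℓ) :
    Real.sqrt ℓ ≤ Real.exp (2 * Real.sqrt (ℓ * Real.log ℓ)) := by
  have h0 : 0 < ℓ := (Real.exp_pos 1).trans_le hℓ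
  have h1 : 1 ≤ Real.log ℓ := (Real.le_log_iff_exp_le h0).2 hℓ
  have h2 : Real.sqrt ℓ ≤ Real.sqrt (ℓ * Real.log ℓ) :=
    Real.sqrt_le_sqrt (le_mul_of_one_le_right h0.le h1)
  have h3 := Real.add_one_le_exp (2 * Real.sqrt (ℓ * Real.log ℓ))
  linarith [Real.sqrt_nonneg (ℓ * Real.log ℓ)]

/-- `A` is the noise sum, `M` the count and `t = r√ℓ` the tilt. Since `M` is at least of order
`r^(-2)`, `2ℓ ≤ (16/b) t^2 M`; dividing by `t` leaves noise of order `t` per point. -/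
lemma abs_noise_le {r ℓ M A b σ : ℝ} (hr : 0 < r) (hℓ : 0 < ℓ) (hb : 0 < b)
    (hM : b / 8 ≤ r ^ 2 * M)
    (hA : |r * Real.sqrt ℓ * A| ≤ 2 * ℓ + σ ^ 2 * (r * Real.sqrt ℓ) ^ 2 / 2 * M) :
    |A| ≤ (16 / b + σ ^ 2 / 2) * (r * Real.sqrt ℓ) * M := by
  have hs : 0 < Real.sqrt ℓ := Real.sqrt_pos.2 hℓ
  have ht : 0 < r * Real.sqrt ℓ := mul_pos hr hs
  rw [abs_mul, abs_of_pos ht] at hA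
  refine le_of_mul_le_mul_left (hA.trans ?_) ht
  have e1 : r * Real.sqrt ℓ * ((16 / b + σ ^ 2 / 2) * (r * Real.sqrt ℓ) * M) =
      16 / b * (r ^ 2 * M) * (Real.sqrt ℓ) ^ 2 + σ ^ 2 * (r * Real.sqrt ℓ) ^ 2 / 2 * M := by ring
  rw [e1, Real.sq_sqrt hℓ.le]
  have e2 : 16 / b * (b / 8) ≤ 16 / b * (r ^ 2 * M) := by gcongr
  have e3 : 16 / b * (b / 8) = 2 := by field_simp; norm_num
  rw [e3] at e2
  have := mul_le_mul_of_nonneg_right e2 hℓ.le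
  linarith

/-- The exponent `u` is at least `(b/8) r^(-2)` and `r^(d+2) = 1/n`, so the term of order `d + 2` in
the series of `e^u` already has size `n^2`. -/
lemma exp_neg_count_le {b : ℝ} (hb : 0 < b) {n N : ℕ} (hn : 1 ≤ n)
    (h : 1 / 2 ≤ ((n : ℝ) ^ (-(1 : ℝ) / (d + 2))) ^ 2 * (n * (1 / 2) ^ N)) :
    Real.exp (-(n * (b * (1 / 2) ^ N) / 4)) ≤
      (d + 2).factorial / (b / 8) ^ (d + 2) * (1 / (n : ℝ) ^ 2) := by
  have hn0 : (0 : ℝ) < n := by exact_mod_cast hn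
  set r := (n : ℝ) ^ (-(1 : ℝ) / (d + 2)) with hr
  have hr0 : 0 < r := Real.rpow_pos_of_pos hn0 _
  have hrn : r ^ (d + 2) = (n : ℝ)⁻¹ := by
    rw [hr, ← Real.rpow_natCast, ← Real.rpow_mul hn0.le, ← Real.rpow_neg_one]
    congr 1
    push_cast
    field_simp
  set u : ℝ := n * (b * (1 / 2) ^ N) / 4 with hu
  have hu0 : 0 < u := by positivity
  have hur : b / 8 ≤ r ^ 2 * u := by
    have : r ^ 2 * u = b / 4 * (r ^ 2 * (n * (1 / 2) ^ N)) := by rw [hu]; ring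
    rw [this]
    nlinarith
  have hpow : (b / 8) ^ (d + 2) * (n : ℝ) ^ 2 ≤ u ^ (d + 2) := by
    have h1 : (b / 8) ^ (d + 2) ≤ (r ^ 2 * u) ^ (d + 2) := by gcongr
    have h2 : (r ^ 2 * u) ^ (d + 2) = u ^ (d + 2) / (n : ℝ) ^ 2 := by
      rw [mul_pow, ← pow_mul, mul_comm 2, pow_mul, hrn]
      field_simp
    rw [h2, le_div_iff₀ (by positivity)] at h1
    exact h1
  have hfac := Real.pow_div_factorial_le_exp u hu0.le (d + 2)
  rw [Real.exp_neg, ← inv_inv ((d + 2).factorial / (b / 8) ^ (d + 2) * (1 / (n : ℝ) ^ 2))]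
  refine inv_anti₀ (by positivity) (le_trans ?_ hfac)
  have e : ((d + 2).factorial / (b / 8) ^ (d + 2) * (1 / (n : ℝ) ^ 2))⁻¹ =
      (b / 8) ^ (d + 2) * (n : ℝ) ^ 2 / (d + 2).factorial := by
    field_simp
  rw [e]
  gcongr

lemma tendsto_splitNumber (hd : 1 ≤ d) {N : ℕ → ℕ}
    (hN : ∀ n : ℕ, 1 ≤ n → |(N n : ℝ) - d * Real.log n / ((d + 2) * Real.log 2)| < 1) :
    Filter.Tendsto N Filter.atTop Filter.atTop := by
  have hd0 : (0 : ℝ) < d := by exact_mod_cast hd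
  have hl2 : 0 < Real.log 2 := Real.log_pos one_lt_two
  have h1 : Filter.Tendsto (fun n : ℕ => d / ((d + 2) * Real.log 2) * Real.log n + -1)
      Filter.atTop Filter.atTop :=
    Filter.tendsto_atTop_add_const_right _ _
      ((Real.tendsto_log_atTop.comp tendsto_natCast_atTop_atTop).const_mul_atTop (by positivity))
  rw [← tendsto_natCast_atTop_iff (R := ℝ)]
  refine Filter.tendsto_atTop_mono' _ ?_ h1
  filter_upwards [Filter.eventually_ge_atTop 1] with n hn
  have := (abs_lt.1 (hN n hn)).1
  have e : d / ((d + 2) * Real.log 2) * Real.log n = d * Real.log n / ((d + 2) * Real.log 2) := by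
    ring
  linarith

end Rates

/-! ### Almost sure rate of a centered tree -/

section Rate

variable {d : ℕ} {Ω : Type*} [MeasurableSpace Ω] {μ : Measure Ω} [IsProbabilityMeasure μ]
  {D : ℕ → Ω → Fin d} {S : ℕ → Ω → ℝ}
  {P : Measure (Covariate d × ℝ)} [IsProbabilityMeasure P] {g : Covariate d → ℝ} {b σ : ℝ}
  {Z : ℕ → Ω → Covariate d × ℝ} {N : ℕ → ℕ}

lemma IsSample.ae_eventually_notMem_badCell (h : IsSample μ P Z) (hg : Measurable g)
    (hsg : SubGaussianNoise P g σ) (hb : 0 < b) (hdens : DensityBoundedBelow P b)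
    (htree : IsCenteredTree μ D S)
    (hind : IndepFun (fun ω i => (D i ω, S i ω)) (fun ω i => Z i ω) μ) (hd : 1 ≤ d)
    (hN : ∀ n : ℕ, 1 ≤ n → |(N n : ℝ) - d * Real.log n / ((d + 2) * Real.log 2)| < 1)
    (x : Covariate d) (t : ℕ → ℝ) :
    ∀ᵐ ω ∂μ, ∀ᶠ n in Filter.atTop, (fun i => Z i ω) ∉ badCell g b σ (t n) (2 * Real.log n) n (N n)
        (treeCell x (fun i => D i ω) (fun _ => 1 / 2) (N n)) := by
  have hsum : (∑' n : ℕ, μ {ω | 1 ≤ n ∧ (fun i => Z i ω) ∈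
      badCell g b σ (t n) (2 * Real.log n) n (N n)
        (treeCell x (fun i => D i ω) (fun _ => 1 / 2) (N n))}) ≠ ∞ := by
    refine ne_top_of_le_ne_top ((Real.summable_one_div_nat_pow.2 one_lt_two).mul_left
      ((d + 2).factorial / (b / 8) ^ (d + 2) + 2)).tsum_ofReal_ne_top
      (ENNReal.tsum_le_tsum fun n => ?_)
    rcases Nat.eq_zero_or_pos n with rfl | hn
    · simp
    have hn0 : (0 : ℝ) < n := by exact_mod_cast hn
    refine (measure_mono fun ω hω => hω.2).trans
      ((h.measure_badCell_random_le hg hsg hb hdens htree hind hd x (t n) (2 * Real.log n) n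
        (N n)).trans (ENNReal.ofReal_le_ofReal ?_))
    have h1 := exp_neg_count_le hb hn (half_pow_bounds hd hn (hN n hn)).1
    have h2 : Real.exp (-(2 * Real.log n)) = 1 / (n : ℝ) ^ 2 := by
      rw [Real.exp_neg, ← Nat.cast_ofNat, ← Real.log_pow, Real.exp_log (by positivity), one_div]
    rw [h2, add_mul]
    linarith
  filter_upwards [ae_eventually_notMem hsum] with ω hω
  filter_upwards [hω, Filter.eventually_ge_atTop 1] with n h1 h2 h3
  exact h1 ⟨h2, h3⟩

/-- The deterministic part of the rate. -/
lemma abs_localAverage_treeCell_sub_le (hb : 0 < b) (hd : 1 ≤ d) {L : ℝ≥0}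
    (hg : LipschitzWith L g) {x : Covariate d} (hx : x ∈ unitCube d) {δ : ℕ → Fin d}
    {w : ℕ → Covariate d × ℝ} {n m : ℕ} (hn : 1 ≤ n) (hlog : Real.exp 1 ≤ Real.log n)
    (hm : |(m : ℝ) - d * Real.log n / ((d + 2) * Real.log 2)| < 1)
    (hcount : ∀ k, m / d - Real.sqrt (m * Real.log m) ≤ (splitCount δ m k : ℝ))
    (hgood : w ∉ badCell g b σ ((n : ℝ) ^ (-(1 : ℝ) / (d + 2)) * Real.sqrt (Real.log n))
      (2 * Real.log n) n m (treeCell x δ (fun _ => 1 / 2) m)) :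
    |localAverage n (treeCell x δ (fun _ => 1 / 2) m) w - g x| ≤
      (L * (d * 2) + (16 / b + σ ^ 2 / 2)) * (n : ℝ) ^ (-(1 : ℝ) / (d + 2)) *
        Real.exp (2 * Real.sqrt (Real.log n * Real.log (Real.log n))) := by
  obtain ⟨h1, h2, h3⟩ := half_pow_bounds hd hn hm
  have hn0 : (0 : ℝ) < n := by exact_mod_cast hn
  set r := (n : ℝ) ^ (-(1 : ℝ) / (d + 2)) with hr
  have hr0 : 0 < r := Real.rpow_pos_of_pos hn0 _
  set ℓ := Real.log n with hℓ
  have hℓ2 : 2 ≤ ℓ := le_trans (by linarith [Real.add_one_le_exp (1 : ℝ)]) hlog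
  set E := Real.exp (2 * Real.sqrt (ℓ * Real.log ℓ)) with hE
  set V := treeCell x δ (fun _ => (1 / 2 : ℝ)) m with hV
  simp only [badCell, Set.mem_union, Set.mem_ofPred_eq, not_or, not_le] at hgood
  obtain ⟨hc, hnoise⟩ := hgood
  have hM : b / 8 ≤ r ^ 2 * cellCount n V w := by
    have h4 : r ^ 2 * (n * (b * (1 / 2) ^ m) / 4) ≤ r ^ 2 * cellCount n V w := by gcongr
    have h5 : r ^ 2 * (n * (b * (1 / 2) ^ m) / 4) = b / 4 * (r ^ 2 * (n * (1 / 2) ^ m)) := by ring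
    rw [h5] at h4
    nlinarith
  have hpos : 0 < cellCount n V w := lt_of_le_of_lt (by positivity) hc
  have hside : ∀ k, (1 / 2 : ℝ) ^ splitCount δ m k ≤ 2 * r * E := by
    intro k
    calc (1 / 2 : ℝ) ^ splitCount δ m k = (2 : ℝ) ^ (-(splitCount δ m k : ℝ)) := by
          rw [Real.rpow_neg two_pos.le, Real.rpow_natCast, one_div, inv_pow]
      _ ≤ (2 : ℝ) ^ (-((m : ℝ) / d) + Real.sqrt (m * Real.log m)) :=
          Real.rpow_le_rpow_of_exponent_le one_le_two (by linarith [hcount k])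
      _ = (2 : ℝ) ^ (-((m : ℝ) / d)) * (2 : ℝ) ^ Real.sqrt (m * Real.log m) :=
          Real.rpow_add two_pos _ _
      _ ≤ 2 * r * E := by
          gcongr
          exact two_rpow_sqrt_le hℓ2 h3
  have hbias : ∀ z ∈ V, |g z - g x| ≤ L * (d * (2 * r * E)) := by
    intro z hz
    refine (hg.dist_le_mul z x).trans ?_
    rw [dist_eq_norm]
    gcongr
    exact norm_sub_le_of_mem_treeCell (fun _ => rfl) hx hz hside
  have hnoise' := abs_noise_le hr0 (by linarith : 0 < ℓ) hb hM hnoise.le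
  refine (abs_localAverage_sub_le hpos hbias hnoise').trans ?_
  have h6 : (16 / b + σ ^ 2 / 2) * (r * Real.sqrt ℓ) ≤ (16 / b + σ ^ 2 / 2) * (r * E) := by
    gcongr
    exact sqrt_le_exp_two_mul_sqrt hlog
  linarith

end Rate

theorem mainTheorem11 (d : ℕ) (hd : 1 ≤ d) :
    (∀ (b σ : ℝ) (L : ℝ≥0), 0 < b → 0 ≤ σ →
      ∃ C : ℝ, 0 < C ∧
        ∀ (Ω : Type*) [MeasurableSpace Ω] (μ : Measure Ω) [IsProbabilityMeasure μ]
          (P : Measure (Covariate d × ℝ)) [IsProbabilityMeasure P] (g : Covariate d → ℝ)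
          (Z : ℕ → Ω → Covariate d × ℝ) (D : ℕ → Ω → Fin d) (S : ℕ → Ω → ℝ)
          (N : ℕ → ℕ) (x : Covariate d),
          IsRegressionFunction P g →
          SubGaussianNoise P g σ →
          DensityBoundedBelow P b →
          LipschitzOnWith L g (unitCube d) →
          IsSample μ P Z →
          IsCenteredTree μ D S →
          IndepFun (fun ω i => (D i ω, S i ω)) (fun ω i => Z i ω) μ →
          (∀ n : ℕ, 1 ≤ n →
            |(N n : ℝ) - d * Real.log n / ((d + 2) * Real.log 2)| < 1) →
          x ∈ unitCube d →
          ∀ᵐ ω ∂μ, ∃ n₀ : ℕ, ∀ n : ℕ, n₀ ≤ n →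
            |localAverage n (treeCell x (fun i => D i ω) (fun i => S i ω) (N n)) (fun i => Z i ω)
                - g x|
              ≤ C * (n : ℝ) ^ (-(1 : ℝ) / (d + 2))
                * Real.exp (2 * Real.sqrt (Real.log n * Real.log (Real.log n)))) ∧
    (2 ≤ d →
      ∀ (Ω : Type*) [MeasurableSpace Ω] (μ : Measure Ω) [IsProbabilityMeasure μ]
        (D : ℕ → Ω → Fin d) (S : ℕ → Ω → ℝ) (x : Covariate d) (N : ℕ),
        IsCenteredTree μ D S → x ∈ unitCube d → d ≤ N →
        (1 / 14 : ℝ≥0∞) ≤ μ {ω |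
          (2 : ℝ) ^ Real.sqrt ((N : ℝ) / d) ≤
            maxSide (treeCell x (fun i => D i ω) (fun i => S i ω) N) /
              minSide (treeCell x (fun i => D i ω) (fun i => S i ω) N)}) := by
  -- The first summand of the constant is the bias, with `d` bounding the `√d` of the diameter and
  -- `2` from rounding; the second is the noise.
  refine ⟨fun b σ L hb _ => ⟨L * (d * 2) + (16 / b + σ ^ 2 / 2), by positivity, ?_⟩, ?_⟩
  · intro Ω _ μ _ P _ g Z D S N x _ hnoise hdens hlip hsample htree hind hN hx
    obtain ⟨g', hg', hgg'⟩ := hlip.extend_real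
    have hnoise' : SubGaussianNoise P g' σ := hnoise.congr <| by
      filter_upwards [hdens.ae_mem_unitCube] with z hz using hgg' hz
    filter_upwards [htree.ae_split_eq, htree.ae_eventually_splitCount_ge,
      hsample.ae_eventually_notMem_badCell hg'.continuous.measurable hnoise' hb hdens htree hind hd
        hN x fun n => (n : ℝ) ^ (-(1 : ℝ) / (d + 2)) * Real.sqrt (Real.log n)] with ω hS hcount hgood
    refine Filter.eventually_atTop.1 ?_
    have hlog := (Real.tendsto_log_atTop.comp tendsto_natCast_atTop_atTop).eventually_ge_atTop
      (Real.exp 1)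
    filter_upwards [(tendsto_splitNumber hd hN).eventually hcount, hgood, hlog,
      Filter.eventually_ge_atTop 1] with n h1 h2 h3 h4
    rw [funext hS, hgg' hx]
    exact abs_localAverage_treeCell_sub_le hb hd hg' hx h4 h3 (hN n h4) h1 h2
  · intro hd2 Ω _ μ _ D S x N htree hx hN
    exact htree.measure_side_ratio_ge hd2 hx hN
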